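/- For every complex number $s$ with $0<\Re(s)<1$, the series $\sum_{m\ge 0} x_m P_m(s)$ converges (absolutely) and $$\zeta(s)=\sum_{m=0}^{+\infty} x_m P_m(s),$$ where $\zeta$ is the Riemann zeta function and, for every integer $m\ge 0$, $$P_m(s)=\sum_{k=0}^m \binom{m}{k}(-1)^k 2^{k+1}\,\frac{(s)_k}{k!},\qquad (s)_0=1,\quad (s)_k=s(s+1)\cdots(s+k-1)\ \ (k\ge 1),$$ $$x_m=\gamma+\sum_{k=1}^m \binom{m}{k}(-2)^k\zeta(k+1)+r_m,$$ $\gamma$ being Euler's constant and $r_m$ the rational numbers $$r_m=(-1)^{m+1}+\sum_{k=1}^m\frac{1+(-1)^{k-1}}{k}.$$ (For $m=0$ the sums over $1\le k\le m$ are empty.) -/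

import Mathlib

/-- The polynomial function `P_m(s) = ∑_{k=0}^m C(m,k) (-1)^k 2^(k+1) (s)_k / k!`, where
`(s)_k = s (s+1) ⋯ (s+k-1)` is the rising factorial. -/
noncomputable def zetaPoly (m : ℕ) (s : ℂ) : ℂ :=
  ∑ k ∈ Finset.range (m + 1),
    (m.choose k : ℂ) * (-1) ^ k * 2 ^ (k + 1) *
      ((ascPochhammer ℂ k).eval s / (k.factorial : ℂ))

/-- The rational numbers `r_m = (-1)^(m+1) + ∑_{k=1}^m (1 + (-1)^(k-1)) / k`. -/
def zetaRat (m : ℕ) : ℚ :=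
  (-1) ^ (m + 1) + ∑ k ∈ Finset.Icc 1 m, (1 + (-1) ^ (k - 1)) / (k : ℚ)

/-- The coefficients `x_m = γ + ∑_{k=1}^m C(m,k) (-2)^k ζ(k+1) + r_m`. -/
noncomputable def zetaCoeff (m : ℕ) : ℂ :=
  (Real.eulerMascheroniConstant : ℂ) +
    ∑ k ∈ Finset.Icc 1 m, (m.choose k : ℂ) * (-2) ^ k * riemannZeta ((k : ℂ) + 1) +
    (zetaRat m : ℂ)

/-!
The proof is an expansion under an integral sign. Put `y = (u - 1) / (u + 1)` and
`g_m(u) = y ^ m / (u + 1)`.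

* The coefficients are `x_m = ∫_0^∞ {u} g_m'(u) du` (`zetaCoeff_eq_integral`), by summation by parts:
  on `[0, N]` the integral is `∑ g_m(n) - ∫ g_m`, and the sum over `n` is evaluated by expanding
  `(1 - 2 / n) ^ m`.
* The functions `g_m` expand a power: `u ^ (-s) = ∑ P_m(s) g_m(u)`, hence
  `∑ P_m(s) g_m'(u) = -s u ^ (-s - 1)` (`hasSum_zetaPoly_mul_cayleyModeDeriv`). Indeed `P_m(s)` is
  proportional to `∫_0^1 (1 - 2 x) ^ m x ^ (s - 1) (1 - x) ^ (-s) dx`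
  (`betaIntegral_mul_zetaPoly`), so that the sum over `m` becomes a differentiated geometric series,
  and the remaining integral is a beta integral after a Möbius substitution.
* In the strip `0 < Re s < 1`, `ζ(s) = -s ∫_0^∞ {u} u ^ (-s - 1) du`
  (`riemannZeta_eq_fract_integral`), by analytic continuation from `Re s > 1`.

The theorem follows by exchanging sum and integral. This is legitimate because
`∫ {u} |g_m'(u)| du ≤ 2 / (m + 1)` (`integral_norm_fract_mul_cayleyModeDeriv_le`) and
`P_m(s) = O(m ^ (-ε))` for some `ε > 0` (`exists_norm_zetaPoly_le`).
-/

open MeasureTheory Set Filter Topology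

/-! ### Powers of the Cayley transform and their derivatives -/

/-- The Cayley transform `u ↦ (u - 1) / (u + 1)`, which maps `(0, ∞)` onto `(-1, 1)`. -/
noncomputable def cayley (u : ℝ) : ℝ := (u - 1) / (u + 1)

/-- The function `g_m(u) = y ^ m / (u + 1)` with `y = (u - 1) / (u + 1)`. It is the Laplace transform
at `u` of the `m`-th Laguerre function `t ↦ exp (-t) L_m(2 t)`. -/
noncomputable def cayleyMode (m : ℕ) (u : ℝ) : ℝ := (u + 1)⁻¹ * cayley u ^ m

/-- The derivative of `cayleyMode m` in closed form (valid for `0 ≤ u`). The truncated exponent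
`m - 1` is harmless, its coefficient `m` vanishing for `m = 0`. -/
noncomputable def cayleyModeDeriv (m : ℕ) (u : ℝ) : ℝ :=
  ((u + 1) ^ 2)⁻¹ * (m * cayley u ^ (m - 1) * (1 - cayley u) - cayley u ^ m)

lemma one_sub_cayley {u : ℝ} (hu : 0 ≤ u) : 1 - cayley u = 2 * (u + 1)⁻¹ := by
  unfold cayley; field_simp; ring

lemma hasDerivAt_cayley {u : ℝ} (hu : 0 ≤ u) : HasDerivAt cayley (2 * ((u + 1) ^ 2)⁻¹) u := by
  have h : u + 1 ≠ 0 := by positivity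
  convert! ((hasDerivAt_id u).sub_const 1).div ((hasDerivAt_id u).add_const 1) h using 1
  simp only [id]; field_simp; ring

lemma abs_cayley_lt_one {u : ℝ} (hu : 0 < u) : |cayley u| < 1 := by
  unfold cayley
  rw [abs_lt, lt_div_iff₀ (by positivity), div_lt_iff₀ (by positivity)]
  constructor <;> linarith

lemma hasDerivAt_cayleyMode (m : ℕ) {u : ℝ} (hu : 0 ≤ u) :
    HasDerivAt (cayleyMode m) (cayleyModeDeriv m u) u := by
  have h : u + 1 ≠ 0 := by positivity
  convert! (((hasDerivAt_id u).add_const 1).inv h).mul ((hasDerivAt_cayley hu).pow m) using 1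
  simp only [id, cayleyModeDeriv, one_sub_cayley hu, Pi.inv_apply, Pi.pow_apply]; field_simp; ring

lemma continuousOn_cayley : ContinuousOn cayley (Ici 0) :=
  fun _ hu => (hasDerivAt_cayley hu).continuousAt.continuousWithinAt

lemma continuousOn_cayleyModeDeriv (m : ℕ) : ContinuousOn (cayleyModeDeriv m) (Ici 0) := by
  have h := continuousOn_cayley
  have h2 : ContinuousOn (fun u : ℝ => ((u + 1) ^ 2)⁻¹) (Ici 0) := by
    refine ContinuousOn.inv₀ (by fun_prop) fun u hu => ?_
    have : (0 : ℝ) ≤ u := hu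
    positivity
  unfold cayleyModeDeriv
  fun_prop

lemma measurable_cayleyModeDeriv (m : ℕ) : Measurable (cayleyModeDeriv m) := by
  unfold cayleyModeDeriv cayley
  fun_prop

/-- The antiderivative `v ^ m - (m - 1) / (m + 1) * v ^ (m + 1)` of `m v ^ (m - 1) (1 - v) + v ^ m`,
whose total increase on `[0, 1]` is at most `2 / (m + 1)`. -/
noncomputable def cayleyModeBoundPrimitive (m : ℕ) (v : ℝ) : ℝ :=
  v ^ m - (m - 1) / (m + 1) * v ^ (m + 1)

lemma hasDerivAt_cayleyModeBoundPrimitive (m : ℕ) (v : ℝ) :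
    HasDerivAt (cayleyModeBoundPrimitive m) (m * v ^ (m - 1) * (1 - v) + v ^ m) v := by
  have h : (m : ℝ) + 1 ≠ 0 := by positivity
  convert! (hasDerivAt_pow m v).sub ((hasDerivAt_pow (m + 1) v).const_mul (((m : ℝ) - 1) / (m + 1)))
    using 1
  rcases m with _ | m
  · simp
  · simp only [Nat.add_sub_cancel]; push_cast; field_simp; ring

lemma cayleyModeBoundPrimitive_one (m : ℕ) : cayleyModeBoundPrimitive m 1 = 2 / (m + 1) := by
  unfold cayleyModeBoundPrimitive; field_simp; ring

lemma cayleyModeBoundPrimitive_zero_nonneg (m : ℕ) : 0 ≤ cayleyModeBoundPrimitive m 0 := by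
  unfold cayleyModeBoundPrimitive
  rw [zero_pow (n := m + 1) (by omega)]
  simp [zero_pow_eq]
  split_ifs <;> simp

lemma tendsto_cayley_atTop : Tendsto cayley atTop (𝓝 1) := by
  have h : Tendsto (fun u : ℝ => 1 - 2 * (u + 1)⁻¹) atTop (𝓝 (1 - 2 * 0)) :=
    ((tendsto_inv_atTop_zero.comp (tendsto_atTop_add_const_right _ 1 tendsto_id)).const_mul
      2).const_sub 1
  simp only [mul_zero, sub_zero] at h
  refine h.congr' ?_
  filter_upwards [eventually_ge_atTop 0] with u hu
  rw [← one_sub_cayley hu]; ring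

/-- The function bounding `{u} |g_m'(u)|`, where `v` stands for `|cayley u|`. -/
noncomputable def cayleyModeBound (m : ℕ) (v : ℝ) (u : ℝ) : ℝ :=
  ((u + 1) ^ 2)⁻¹ * (m * v ^ (m - 1) * (1 - v) + v ^ m)

/-- On `(0, 1]` the factor `{u} ≤ u` is what makes the bound small: with `v = -cayley u` one has
`u (1 - cayley u) = 1 - v`. -/
lemma norm_fract_mul_cayleyModeDeriv_le_Ioc (m : ℕ) {u : ℝ} (hu : u ∈ Ioc (0 : ℝ) 1) :
    ‖Int.fract u * cayleyModeDeriv m u‖ ≤ cayleyModeBound m (-cayley u) u := by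
  obtain ⟨h0, h1⟩ := hu
  have hv0 : 0 ≤ -cayley u := by
    unfold cayley; rw [← neg_div]; apply div_nonneg <;> linarith
  have hv1 : 0 ≤ 1 - -cayley u := by
    have := abs_lt.1 (abs_cayley_lt_one h0); linarith
  have hy : 0 ≤ 1 - cayley u := by linarith
  have hfr : Int.fract u ≤ u := by
    have : (0 : ℤ) ≤ ⌊u⌋ := Int.floor_nonneg.2 h0.le
    have : (0 : ℝ) ≤ ⌊u⌋ := by exact_mod_cast this
    unfold Int.fract; linarith
  have hu2 : u * (1 - cayley u) = 1 - -cayley u := by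
    unfold cayley; field_simp; ring
  rw [Real.norm_eq_abs, abs_mul, abs_of_nonneg (Int.fract_nonneg u)]
  refine (mul_le_mul_of_nonneg_right hfr (abs_nonneg _)).trans ?_
  unfold cayleyModeDeriv cayleyModeBound
  rw [abs_mul, abs_of_nonneg (by positivity : 0 ≤ ((u + 1) ^ 2)⁻¹), mul_left_comm]
  refine mul_le_mul_of_nonneg_left ?_ (by positivity)
  refine (mul_le_mul_of_nonneg_left (abs_sub _ _) h0.le).trans ?_
  rw [abs_mul, abs_mul, abs_pow, abs_pow, Nat.abs_cast, abs_of_nonneg hy, ← abs_neg (cayley u),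
    abs_of_nonneg hv0, mul_add]
  refine add_le_add (le_of_eq ?_) (mul_le_of_le_one_left (by positivity) h1)
  rw [mul_left_comm, hu2]

lemma norm_fract_mul_cayleyModeDeriv_le_Ioi (m : ℕ) {u : ℝ} (hu : u ∈ Ioi (1 : ℝ)) :
    ‖Int.fract u * cayleyModeDeriv m u‖ ≤ cayleyModeBound m (cayley u) u := by
  have h1 : (1 : ℝ) < u := hu
  have hv0 : 0 ≤ cayley u := by
    unfold cayley; apply div_nonneg <;> linarith
  have hy : 0 ≤ 1 - cayley u := by
    have := abs_lt.1 (abs_cayley_lt_one (zero_lt_one.trans h1)); linarith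
  rw [Real.norm_eq_abs, abs_mul, abs_of_nonneg (Int.fract_nonneg u)]
  refine (mul_le_of_le_one_left (abs_nonneg _) (Int.fract_lt_one u).le).trans ?_
  unfold cayleyModeDeriv cayleyModeBound
  rw [abs_mul, abs_of_nonneg (by positivity : 0 ≤ ((u + 1) ^ 2)⁻¹)]
  refine mul_le_mul_of_nonneg_left ((abs_sub _ _).trans (le_of_eq ?_)) (by positivity)
  rw [abs_of_nonneg (by positivity), abs_of_nonneg (by positivity)]

lemma aestronglyMeasurable_fract_mul_cayleyModeDeriv (m : ℕ) (μ : Measure ℝ) :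
    AEStronglyMeasurable (fun u => Int.fract u * cayleyModeDeriv m u) μ :=
  (measurable_fract.mul (measurable_cayleyModeDeriv m)).aestronglyMeasurable

lemma fract_mul_cayleyModeDeriv_Ioc (m : ℕ) :
    IntegrableOn (fun u => Int.fract u * cayleyModeDeriv m u) (Ioc 0 1) ∧
    ∫ u in Ioc (0 : ℝ) 1, ‖Int.fract u * cayleyModeDeriv m u‖ ≤ 1 / (m + 1) := by
  have hder : ∀ u ∈ uIcc (0 : ℝ) 1, HasDerivAt (fun u =>
      -(2⁻¹ * cayleyModeBoundPrimitive m (-cayley u)))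
      (cayleyModeBound m (-cayley u) u) u := by
    intro u hu
    rw [uIcc_of_le zero_le_one] at hu
    convert! (((hasDerivAt_cayleyModeBoundPrimitive m _).comp u
      (hasDerivAt_cayley hu.1).neg).const_mul
      2⁻¹).neg using 1
    simp only [cayleyModeBound, Pi.neg_apply]; ring
  have hc : ContinuousOn (fun u => cayleyModeBound m (-cayley u) u) (uIcc (0 : ℝ) 1) := by
    rw [uIcc_of_le zero_le_one]
    have h := continuousOn_cayley.mono (Icc_subset_Ici_self : Icc (0 : ℝ) 1 ⊆ _)
    have h2 : ContinuousOn (fun u : ℝ => ((u + 1) ^ 2)⁻¹) (Icc 0 1) := by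
      refine ContinuousOn.inv₀ (by fun_prop) fun u hu => ?_
      have : (0 : ℝ) ≤ u := hu.1
      positivity
    unfold cayleyModeBound
    fun_prop
  have hint := intervalIntegral.integral_eq_sub_of_hasDerivAt hder hc.intervalIntegrable
  have hI : IntegrableOn (fun u => cayleyModeBound m (-cayley u) u) (Ioc 0 1) :=
    (intervalIntegrable_iff_integrableOn_Ioc_of_le zero_le_one).1 hc.intervalIntegrable
  have hle : ∀ᵐ u ∂(volume.restrict (Ioc (0 : ℝ) 1)),
      ‖Int.fract u * cayleyModeDeriv m u‖ ≤ cayleyModeBound m (-cayley u) u :=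
    (ae_restrict_iff' measurableSet_Ioc).2 (ae_of_all _ fun u hu =>
      norm_fract_mul_cayleyModeDeriv_le_Ioc m hu)
  have hF := hI.mono' (aestronglyMeasurable_fract_mul_cayleyModeDeriv m _) hle
  refine ⟨hF, (integral_mono_ae hF.norm hI hle).trans ?_⟩
  rw [← intervalIntegral.integral_of_le zero_le_one, hint]
  have h0 : -cayley 0 = 1 := by norm_num [cayley]
  have h1 : -cayley 1 = 0 := by norm_num [cayley]
  have := cayleyModeBoundPrimitive_zero_nonneg m
  rw [h0, h1, cayleyModeBoundPrimitive_one]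
  ring_nf; ring_nf at this; linarith

lemma fract_mul_cayleyModeDeriv_Ioi (m : ℕ) :
    IntegrableOn (fun u => Int.fract u * cayleyModeDeriv m u) (Ioi 1) ∧
    ∫ u in Ioi (1 : ℝ), ‖Int.fract u * cayleyModeDeriv m u‖ ≤ 1 / (m + 1) := by
  have hder : ∀ u ∈ Ici (1 : ℝ), HasDerivAt (fun u => 2⁻¹ * cayleyModeBoundPrimitive m (cayley u))
      (cayleyModeBound m (cayley u) u) u := by
    intro u hu
    convert! ((hasDerivAt_cayleyModeBoundPrimitive m _).comp u
      (hasDerivAt_cayley (zero_le_one.trans hu))).const_mul 2⁻¹ using 1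
    unfold cayleyModeBound; ring
  have hpos : ∀ u ∈ Ioi (1 : ℝ), 0 ≤ cayleyModeBound m (cayley u) u := fun u hu =>
    (norm_nonneg _).trans (norm_fract_mul_cayleyModeDeriv_le_Ioi m hu)
  have hlim : Tendsto (fun u => 2⁻¹ * cayleyModeBoundPrimitive m (cayley u)) atTop
      (𝓝 (2⁻¹ * cayleyModeBoundPrimitive m 1)) :=
    ((hasDerivAt_cayleyModeBoundPrimitive m 1).continuousAt.tendsto.comp
      tendsto_cayley_atTop).const_mul _
  have hI := integrableOn_Ioi_deriv_of_nonneg' hder hpos hlim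
  have hint := integral_Ioi_of_hasDerivAt_of_nonneg' hder hpos hlim
  have hle : ∀ᵐ u ∂(volume.restrict (Ioi (1 : ℝ))),
      ‖Int.fract u * cayleyModeDeriv m u‖ ≤ cayleyModeBound m (cayley u) u :=
    (ae_restrict_iff' measurableSet_Ioi).2 (ae_of_all _ fun u hu =>
      norm_fract_mul_cayleyModeDeriv_le_Ioi m hu)
  have hF := hI.mono' (aestronglyMeasurable_fract_mul_cayleyModeDeriv m _) hle
  refine ⟨hF, (integral_mono_ae hF.norm hI hle).trans ?_⟩
  rw [hint]
  have h1 : cayley 1 = 0 := by norm_num [cayley]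
  have := cayleyModeBoundPrimitive_zero_nonneg m
  rw [h1, cayleyModeBoundPrimitive_one]
  ring_nf; ring_nf at this; linarith

lemma integrableOn_fract_mul_cayleyModeDeriv (m : ℕ) :
    IntegrableOn (fun u => Int.fract u * cayleyModeDeriv m u) (Ioi 0) := by
  rw [← Ioc_union_Ioi_eq_Ioi zero_le_one]
  exact (fract_mul_cayleyModeDeriv_Ioc m).1.union (fract_mul_cayleyModeDeriv_Ioi m).1

/-- The decay `O(1 / m)` of the coefficients, in the absolute form that allows the sum over `m` to be
exchanged with the integral over `u`. -/
lemma integral_norm_fract_mul_cayleyModeDeriv_le (m : ℕ) :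
    ∫ u in Ioi (0 : ℝ), ‖Int.fract u * cayleyModeDeriv m u‖ ≤ 2 / (m + 1) := by
  rw [← Ioc_union_Ioi_eq_Ioi zero_le_one, setIntegral_union (Ioc_disjoint_Ioi le_rfl)
    measurableSet_Ioi (fract_mul_cayleyModeDeriv_Ioc m).1.norm
    (fract_mul_cayleyModeDeriv_Ioi m).1.norm]
  refine (add_le_add (fract_mul_cayleyModeDeriv_Ioc m).2 (fract_mul_cayleyModeDeriv_Ioi m).2).trans
    (le_of_eq ?_)
  ring

/-! ### The coefficients as integrals -/

/-- The antiderivative `log (u + 1) - ∑_{k < m} y ^ (k + 1) / (k + 1)`, `y = cayley u`, of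
`cayleyMode m` on `[0, ∞)`. -/
noncomputable def cayleyModePrimitive (m : ℕ) (u : ℝ) : ℝ :=
  Real.log (u + 1) - ∑ k ∈ Finset.range m, cayley u ^ (k + 1) / (k + 1)

lemma hasDerivAt_cayleyModePrimitive (m : ℕ) {u : ℝ} (hu : 0 ≤ u) :
    HasDerivAt (cayleyModePrimitive m) (cayleyMode m u) u := by
  have h : u + 1 ≠ 0 := by positivity
  have h1 : HasDerivAt (fun u => ∑ k ∈ Finset.range m, cayley u ^ (k + 1) / ((k : ℝ) + 1))
      (∑ k ∈ Finset.range m, cayley u ^ k * (2 * ((u + 1) ^ 2)⁻¹)) u := by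
    refine HasDerivAt.fun_sum fun k _ => ?_
    have hk : (k : ℝ) + 1 ≠ 0 := by positivity
    convert! ((hasDerivAt_cayley hu).pow (k + 1)).div_const ((k : ℝ) + 1) using 1
    simp only [Nat.add_sub_cancel]; push_cast; field_simp
  convert! (((hasDerivAt_id u).add_const 1).log h).sub h1 using 1
  have h2 := mul_neg_geom_sum (cayley u) m
  rw [one_sub_cayley hu] at h2
  rw [← Finset.sum_mul, cayleyMode, (by linarith : cayley u ^ m = 1 - 2 * (u + 1)⁻¹ *
    ∑ i ∈ Finset.range m, cayley u ^ i)]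
  simp only [id]; field_simp

lemma integral_fract_mul_cayleyModeDeriv_unit (m n : ℕ) :
    ∫ u in (n : ℝ)..((n + 1 : ℕ) : ℝ), Int.fract u * cayleyModeDeriv m u =
      cayleyMode m (n + 1) - (cayleyModePrimitive m (n + 1 : ℕ) - cayleyModePrimitive m n) := by
  have hn : (0 : ℝ) ≤ n := n.cast_nonneg
  have hle : (n : ℝ) ≤ (n + 1 : ℕ) := by push_cast; linarith
  have hcongr : ∫ u in (n : ℝ)..((n + 1 : ℕ) : ℝ), Int.fract u * cayleyModeDeriv m u =
      ∫ u in (n : ℝ)..((n + 1 : ℕ) : ℝ), (u - n) * cayleyModeDeriv m u := by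
    rw [intervalIntegral.integral_of_le hle, intervalIntegral.integral_of_le hle,
      integral_Ioc_eq_integral_Ioo, integral_Ioc_eq_integral_Ioo]
    -- `{u} = u - n` fails only at the right endpoint
    refine setIntegral_congr_fun measurableSet_Ioo fun u hu => ?_
    have : ⌊u⌋ = (n : ℤ) := by
      rw [Int.floor_eq_iff]
      have := hu.2
      push_cast at this ⊢
      exact ⟨hu.1.le, this⟩
    simp [Int.fract, this]
  have hsub : uIcc (n : ℝ) ((n + 1 : ℕ) : ℝ) ⊆ Ici 0 := by
    rw [uIcc_of_le hle]; exact fun u hu => hn.trans hu.1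
  have hder : ∀ u ∈ uIcc (n : ℝ) ((n + 1 : ℕ) : ℝ), HasDerivAt
      (fun u => (u - n) * cayleyMode m u - cayleyModePrimitive m u)
      ((u - n) * cayleyModeDeriv m u) u := by
    intro u hu
    convert! (((hasDerivAt_id u).sub_const (n : ℝ)).mul (hasDerivAt_cayleyMode m (hsub hu))).sub
      (hasDerivAt_cayleyModePrimitive m (hsub hu)) using 1
    simp
  have hc : ContinuousOn (fun u => (u - n) * cayleyModeDeriv m u)
      (uIcc (n : ℝ) ((n + 1 : ℕ) : ℝ)) := by
    have := (continuousOn_cayleyModeDeriv m).mono hsub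
    fun_prop
  rw [hcongr, intervalIntegral.integral_eq_sub_of_hasDerivAt hder hc.intervalIntegrable]
  push_cast
  ring

lemma integral_fract_mul_cayleyModeDeriv_nat (m N : ℕ) :
    ∫ u in (0 : ℝ)..(N : ℝ), Int.fract u * cayleyModeDeriv m u =
      ∑ n ∈ Finset.range N, cayleyMode m (n + 1) -
        (cayleyModePrimitive m N - cayleyModePrimitive m 0) := by
  have h := intervalIntegral.sum_integral_adjacent_intervals (μ := volume)
    (f := fun u => Int.fract u * cayleyModeDeriv m u) (a := fun n : ℕ => (n : ℝ)) (n := N) ?_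
  · simp only [Nat.cast_zero] at h
    rw [← h, Finset.sum_congr rfl fun n _ => integral_fract_mul_cayleyModeDeriv_unit m n,
      Finset.sum_sub_distrib, Finset.sum_range_sub (fun n : ℕ => cayleyModePrimitive m n)]
    simp
  · intro k _
    rw [intervalIntegrable_iff_integrableOn_Ioc_of_le (by push_cast; linarith)]
    exact (integrableOn_fract_mul_cayleyModeDeriv m).mono_set fun u hu =>
      lt_of_le_of_lt k.cast_nonneg hu.1

lemma tendsto_sum_inv_pow (k : ℕ) :
    Tendsto (fun N : ℕ => ∑ n ∈ Finset.range (N + 1), (1 / ((n : ℂ) + 1) ^ (k + 1 + 1))) atTop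
      (𝓝 (riemannZeta ((k + 1 : ℕ) + 1))) := by
  have h1 := zeta_nat_eq_tsum_of_gt_one (k := k + 1 + 1) (by omega)
  have hs : Summable fun n : ℕ => 1 / (n : ℂ) ^ (k + 1 + 1) := by
    have := (Real.summable_one_div_nat_pow (p := k + 1 + 1)).2 (by omega)
    simpa using Complex.ofRealCLM.summable this
  have h2 := ((hasSum_nat_add_iff' 1).2 hs.hasSum).tendsto_sum_nat.comp (tendsto_add_atTop_nat 1)
  rw [← h1] at h2
  simpa [Function.comp_def] using h2

/-- Since `cayley n = 1 - 2 / (n + 1)`, the sum is expanded by the binomial theorem. Its `n = 0` term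
`(-1) ^ m`, absent on the left, is added and subtracted to obtain sums over all positive
integers. -/
lemma sum_cayleyMode (m N : ℕ) :
    ((∑ n ∈ Finset.range N, cayleyMode m (n + 1) : ℝ) : ℂ) =
      (harmonic (N + 1) : ℂ) + ∑ k ∈ Finset.range m, ((m.choose (k + 1) : ℂ) * (-2) ^ (k + 1) *
        ∑ n ∈ Finset.range (N + 1), (1 / ((n : ℂ) + 1) ^ (k + 1 + 1))) - (-1) ^ m := by
  have h1 : ∀ n : ℕ, (1 / ((n : ℂ) + 1)) * (1 + -2 / ((n : ℂ) + 1)) ^ m =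
      1 / ((n : ℂ) + 1) + ∑ k ∈ Finset.range m, ((m.choose (k + 1) : ℂ) * (-2) ^ (k + 1) *
        (1 / ((n : ℂ) + 1) ^ (k + 1 + 1))) := by
    intro n
    have hn : (n : ℂ) + 1 ≠ 0 := by exact_mod_cast n.succ_ne_zero
    rw [add_comm 1 (-2 / _), add_pow, Finset.sum_range_succ', mul_add, Finset.mul_sum, add_comm]
    congr 1
    · simp
    · refine Finset.sum_congr rfl fun k _ => ?_
      rw [div_pow, one_pow, pow_succ ((n : ℂ) + 1) (k + 1)]; field_simp
  have h2 : (∑ n ∈ Finset.range (N + 1), (1 / ((n : ℂ) + 1)) * (1 + -2 / ((n : ℂ) + 1)) ^ m) =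
      ((∑ n ∈ Finset.range N, cayleyMode m (n + 1) : ℝ) : ℂ) + (-1) ^ m := by
    rw [Finset.sum_range_succ']
    push_cast
    congr 1
    · refine Finset.sum_congr rfl fun n _ => ?_
      have hn : (n : ℂ) + 1 + 1 ≠ 0 := by exact_mod_cast (n + 1).succ_ne_zero
      simp only [cayleyMode, cayley]
      push_cast
      rw [one_div]
      congr 2
      field_simp; ring
    · norm_num
  rw [eq_sub_iff_add_eq, ← h2, Finset.sum_congr rfl fun n _ => h1 n, Finset.sum_add_distrib,
    Finset.sum_comm]
  congr 1
  · simp [harmonic]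
  · simp_rw [Finset.mul_sum]

lemma tendsto_cayleyModePrimitive (m : ℕ) :
    Tendsto (fun N : ℕ => cayleyModePrimitive m N - Real.log ((N + 1 : ℕ) : ℝ)) atTop
      (𝓝 (-∑ k ∈ Finset.range m, 1 / ((k : ℝ) + 1))) := by
  have h : Tendsto (fun N : ℕ => -∑ k ∈ Finset.range m, cayley N ^ (k + 1) / ((k : ℝ) + 1)) atTop
      (𝓝 (-∑ k ∈ Finset.range m, 1 ^ (k + 1) / ((k : ℝ) + 1))) :=
    (tendsto_finsetSum _ fun k _ =>
      ((tendsto_cayley_atTop.comp tendsto_natCast_atTop_atTop).pow _).div_const _).neg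
  simp only [one_pow] at h
  refine h.congr fun N => ?_
  simp [cayleyModePrimitive]

lemma zetaRat_eq (m : ℕ) : (zetaRat m : ℂ) =
    -(-1) ^ m + ∑ k ∈ Finset.range m, (1 + (-1) ^ k) / ((k : ℂ) + 1) := by
  rw [zetaRat, ← Finset.Ico_add_one_right_eq_Icc, Finset.sum_Ico_eq_sum_range]
  push_cast
  congr 1
  · ring
  · refine Finset.sum_congr rfl fun k _ => ?_
    simp [add_comm]

/-- Summation by parts: both sides are the limit of `∑_{1 ≤ n ≤ N} g_m(n) - ∫_0^N g_m`, where the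
divergences of the harmonic sum and of `log (N + 1)` cancel and leave Euler's constant. -/
lemma zetaCoeff_eq_integral (m : ℕ) :
    zetaCoeff m = ((∫ u in Ioi (0 : ℝ), Int.fract u * cayleyModeDeriv m u : ℝ) : ℂ) := by
  have hlim := intervalIntegral_tendsto_integral_Ioi 0
    (integrableOn_fract_mul_cayleyModeDeriv m) tendsto_natCast_atTop_atTop
  have hlim' := (Complex.continuous_ofReal.tendsto _).comp hlim
  refine tendsto_nhds_unique ?_ hlim'
  have hγ := (Complex.continuous_ofReal.tendsto _).comp
    (Real.tendsto_harmonic_sub_log.comp (tendsto_add_atTop_nat 1))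
  have hA := (Complex.continuous_ofReal.tendsto _).comp (tendsto_cayleyModePrimitive m)
  have hζ := tendsto_finsetSum (Finset.range m) fun k _ =>
    (tendsto_sum_inv_pow k).const_mul ((m.choose (k + 1) : ℂ) * (-2) ^ (k + 1))
  have h := (((hγ.add hζ).sub_const ((-1) ^ m)).sub hA).add_const
    ((cayleyModePrimitive m 0 : ℝ) : ℂ)
  convert h using 1
  · funext N
    simp only [Function.comp_apply, integral_fract_mul_cayleyModeDeriv_nat]
    rw [Complex.ofReal_sub, sum_cayleyMode]
    push_cast
    ring
  · congr 1
    rw [zetaCoeff, zetaRat_eq, ← Finset.Ico_add_one_right_eq_Icc, Finset.sum_Ico_eq_sum_range]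
    have h0 : ((cayleyModePrimitive m 0 : ℝ) : ℂ) =
        ∑ k ∈ Finset.range m, (-1) ^ k / ((k : ℂ) + 1) := by
      simp only [cayleyModePrimitive, cayley]
      push_cast
      norm_num [← Finset.sum_neg_distrib]
      refine Finset.sum_congr rfl fun k _ => ?_
      ring_nf
    rw [h0]
    push_cast
    simp only [add_div, Finset.sum_add_distrib, add_comm 1]
    ring_nf

/-! ### The polynomials as moments of a beta weight -/

/-- The weight `x ^ (s - 1) (1 - x) ^ (-s)` on `(0, 1)`, of total mass `B(s, 1 - s)`. -/
noncomputable def betaWeight (s : ℂ) (x : ℝ) : ℂ := (x : ℂ) ^ (s - 1) * (1 - (x : ℂ)) ^ (-s)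

lemma integrableOn_betaKernel {u v : ℂ} (hu : 0 < u.re) (hv : 0 < v.re) :
    IntegrableOn (fun x : ℝ => (x : ℂ) ^ (u - 1) * (1 - (x : ℂ)) ^ (v - 1)) (Ioo 0 1) :=
  ((intervalIntegrable_iff_integrableOn_Ioc_of_le zero_le_one).1
    (Complex.betaIntegral_convergent hu hv)).mono_set Ioo_subset_Ioc_self

lemma setIntegral_betaKernel (u v : ℂ) :
    ∫ x in Ioo (0 : ℝ) 1, (x : ℂ) ^ (u - 1) * (1 - (x : ℂ)) ^ (v - 1) = u.betaIntegral v := by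
  rw [Complex.betaIntegral, intervalIntegral.integral_of_le zero_le_one,
    integral_Ioc_eq_integral_Ioo]

lemma pow_mul_betaWeight (s : ℂ) (k : ℕ) {x : ℝ} (hx : x ∈ Ioo (0 : ℝ) 1) :
    (x : ℂ) ^ k * betaWeight s x =
      (x : ℂ) ^ (s + k - 1) * (1 - (x : ℂ)) ^ ((1 - s) - 1) := by
  have hx0 : (x : ℂ) ≠ 0 := by exact_mod_cast hx.1.ne'
  rw [betaWeight, show s + k - 1 = (k : ℂ) + (s - 1) by ring, Complex.cpow_add _ _ hx0,
    Complex.cpow_natCast, show 1 - s - 1 = -s by ring, mul_assoc]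

section

variable {s : ℂ}

lemma integrableOn_pow_mul_betaWeight (hs0 : 0 < s.re) (hs1 : s.re < 1) (k : ℕ) :
    IntegrableOn (fun x : ℝ => (x : ℂ) ^ k * betaWeight s x) (Ioo 0 1) := by
  have h := integrableOn_betaKernel (u := s + k) (v := 1 - s)
    (by simp; positivity) (by simpa using hs1)
  exact h.congr_fun (fun x hx => (pow_mul_betaWeight s k hx).symm) measurableSet_Ioo

lemma integrableOn_betaWeight (hs0 : 0 < s.re) (hs1 : s.re < 1) :
    IntegrableOn (betaWeight s) (Ioo 0 1) := by
  simpa using integrableOn_pow_mul_betaWeight hs0 hs1 0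

lemma betaIntegral_one_sub_ne_zero (hs0 : 0 < s.re) (hs1 : s.re < 1) :
    s.betaIntegral (1 - s) ≠ 0 := by
  have hs1' : 0 < (1 - s).re := by simpa using hs1
  have h := Complex.Gamma_mul_Gamma_eq_betaIntegral hs0 hs1'
  intro h0
  rw [h0, mul_zero] at h
  exact mul_ne_zero (Complex.Gamma_ne_zero_of_re_pos hs0)
    (Complex.Gamma_ne_zero_of_re_pos hs1') h

/-- The `k`-th moment is `B(s + k, 1 - s) = (s)_k / k! * B(s, 1 - s)`. -/
lemma integral_pow_mul_betaWeight (hs0 : 0 < s.re) (hs1 : s.re < 1) (k : ℕ) :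
    ∫ x in Ioo (0 : ℝ) 1, (x : ℂ) ^ k * betaWeight s x =
      (ascPochhammer ℂ k).eval s / (k.factorial : ℂ) * s.betaIntegral (1 - s) := by
  have hs1' : 0 < (1 - s).re := by simpa using hs1
  have hsk : 0 < (s + k).re := by simp; positivity
  have hΓ := Complex.Gamma_ne_zero_of_re_pos hs0
  have h1 := Complex.Gamma_mul_Gamma_eq_betaIntegral hs0 hs1'
  have h2 := Complex.Gamma_mul_Gamma_eq_betaIntegral hsk hs1'
  rw [show s + k + (1 - s) = (k : ℂ) + 1 by ring, Complex.Gamma_nat_eq_factorial] at h2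
  rw [add_sub_cancel, Complex.Gamma_one, one_mul] at h1
  have hne : ∀ n : ℕ, s ≠ -n := by
    rintro n rfl
    simp at hs0
    linarith [n.cast_nonneg (α := ℝ)]
  have hk : (k.factorial : ℂ) ≠ 0 := by exact_mod_cast k.factorial_ne_zero
  rw [setIntegral_congr_fun measurableSet_Ioo fun x hx => pow_mul_betaWeight s k hx,
    setIntegral_betaKernel, ← Complex.Gamma_add_nat_div_Gamma_eq s hne, ← h1]
  field_simp
  rw [mul_comm, ← h2]

/-- The values `P_m(s)` are, up to a constant, moments of the beta weight with respect to
`1 - 2 x ∈ (-1, 1)`. -/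
lemma betaIntegral_mul_zetaPoly (hs0 : 0 < s.re) (hs1 : s.re < 1) (m : ℕ) :
    s.betaIntegral (1 - s) * zetaPoly m s =
      2 * ∫ x in Ioo (0 : ℝ) 1, (1 - 2 * (x : ℂ)) ^ m * betaWeight s x := by
  have h : ∀ x : ℝ, (1 - 2 * (x : ℂ)) ^ m * betaWeight s x =
      ∑ k ∈ Finset.range (m + 1), ((m.choose k : ℂ) * (-2) ^ k) *
        ((x : ℂ) ^ k * betaWeight s x) := by
    intro x
    rw [show 1 - 2 * (x : ℂ) = -2 * x + 1 by ring, add_pow, Finset.sum_mul]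
    refine Finset.sum_congr rfl fun k _ => ?_
    rw [mul_pow, one_pow]; ring
  simp_rw [h]
  rw [integral_finsetSum _ fun k _ => (integrableOn_pow_mul_betaWeight hs0 hs1 k).const_mul _]
  simp_rw [integral_const_mul, integral_pow_mul_betaWeight hs0 hs1]
  rw [zetaPoly, Finset.mul_sum, Finset.mul_sum]
  refine Finset.sum_congr rfl fun k _ => ?_
  rw [show (-2 : ℂ) = (-1) * 2 by ring, mul_pow]; ring

/-- The bound `|1 - 2 x| ^ m ≤ (m x (1 - x)) ^ (-ε)`, which trades a little integrability at the
endpoints for decay in `m`. -/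
lemma abs_one_sub_pow_mul_rpow_le {ε : ℝ} (hε0 : 0 ≤ ε) (hε1 : ε ≤ 1) (m : ℕ) {x : ℝ}
    (hx : x ∈ Ioo (0 : ℝ) 1) : |1 - 2 * x| ^ m * (m * (x * (1 - x))) ^ ε ≤ 1 := by
  obtain ⟨h0, h1⟩ := hx
  have h1' : 0 < 1 - x := by linarith
  have hv : |1 - 2 * x| ≤ 1 - x * (1 - x) := by
    rw [abs_le]; constructor <;> nlinarith
  set v := x * (1 - x)
  have hv0 : 0 < v := by positivity
  have hv1 : 0 ≤ 1 - v := (abs_nonneg _).trans hv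
  have hmv : 0 ≤ m * v := by positivity
  have hb : (m * v) ^ ε ≤ (1 + v) ^ m := calc
    (m * v) ^ ε ≤ (1 + m * v) ^ ε := Real.rpow_le_rpow hmv (by linarith) hε0
    _ ≤ (1 + m * v) ^ (1 : ℝ) := Real.rpow_le_rpow_of_exponent_le (by linarith) hε1
    _ ≤ (1 + v) ^ m := by
      rw [Real.rpow_one]; exact one_add_mul_le_pow (by linarith) m
  calc |1 - 2 * x| ^ m * (m * v) ^ ε ≤ (1 - v) ^ m * (1 + v) ^ m := by gcongr
    _ = (1 - v * v) ^ m := by rw [← mul_pow]; ring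
    _ ≤ 1 := pow_le_one₀ (by nlinarith) (by nlinarith)

lemma exists_norm_zetaPoly_le (hs0 : 0 < s.re) (hs1 : s.re < 1) :
    ∃ ε : ℝ, 0 < ε ∧ ∃ C : ℝ, ∀ m : ℕ, m ≠ 0 → ‖zetaPoly m s‖ ≤ C * (m : ℝ) ^ (-ε) := by
  -- half the distance from `s.re` to the boundary of the strip keeps the two shifted beta exponents
  -- positive
  set ε := min s.re (1 - s.re) / 2 with hε
  have hε0 : 0 < ε := half_pos (lt_min hs0 (by linarith))
  have h1 : 0 < (s - ε).re := by
    have := min_le_left s.re (1 - s.re)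
    simp; linarith
  have h2 : 0 < (1 - s - ε).re := by
    have := min_le_right s.re (1 - s.re)
    simp; linarith
  have hI := (integrableOn_betaKernel h1 h2).norm
  set K := ∫ x in Ioo (0 : ℝ) 1, ‖(x : ℂ) ^ (s - ε - 1) * (1 - (x : ℂ)) ^ (1 - s - ε - 1)‖
  set B := s.betaIntegral (1 - s)
  have hB : 0 < ‖B‖ := norm_pos_iff.2 (betaIntegral_one_sub_ne_zero hs0 hs1)
  refine ⟨ε, hε0, 2 * K / ‖B‖, fun m hm => ?_⟩
  have hm0 : (0 : ℝ) < m := by exact_mod_cast Nat.pos_of_ne_zero hm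
  have hle : ∀ x ∈ Ioo (0 : ℝ) 1, ‖(1 - 2 * (x : ℂ)) ^ m * betaWeight s x‖ ≤
      (m : ℝ) ^ (-ε) * ‖(x : ℂ) ^ (s - ε - 1) * (1 - (x : ℂ)) ^ (1 - s - ε - 1)‖ := by
    intro x hx
    have hx0 := hx.1
    have hx1 : 0 < 1 - x := by linarith [hx.2]
    have h := abs_one_sub_pow_mul_rpow_le hε0.le
      (by have := min_le_left s.re (1 - s.re); linarith) m hx
    have hcast : (1 : ℂ) - x = ((1 - x : ℝ) : ℂ) := by push_cast; ring
    have hn : ‖1 - 2 * (x : ℂ)‖ = |1 - 2 * x| := by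
      rw [← Real.norm_eq_abs, ← Complex.norm_real]; push_cast; rfl
    rw [Real.mul_rpow hm0.le (by positivity), Real.mul_rpow hx0.le hx1.le] at h
    rw [betaWeight, norm_mul, norm_mul, norm_mul, norm_pow, hn, hcast,
      Complex.norm_cpow_eq_rpow_re_of_pos hx0, Complex.norm_cpow_eq_rpow_re_of_pos hx1,
      Complex.norm_cpow_eq_rpow_re_of_pos hx0, Complex.norm_cpow_eq_rpow_re_of_pos hx1]
    have e1 : (s - 1).re = (s - ε - 1).re + ε := by simp; ring
    have e2 : (-s).re = (1 - s - ε - 1).re + ε := by simp; ring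
    rw [e1, e2, Real.rpow_add hx0, Real.rpow_add hx1, Real.rpow_neg hm0.le]
    set a := x ^ (s - ε - 1).re
    set b := (1 - x) ^ (1 - s - ε - 1).re
    have hmε : 0 < (m : ℝ) ^ ε := by positivity
    rw [inv_mul_eq_div, le_div_iff₀ hmε]
    calc |1 - 2 * x| ^ m * (a * x ^ ε * (b * (1 - x) ^ ε)) * (m : ℝ) ^ ε
        = (|1 - 2 * x| ^ m * ((m : ℝ) ^ ε * (x ^ ε * (1 - x) ^ ε))) * (a * b) := by ring
      _ ≤ 1 * (a * b) := by gcongr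
      _ = a * b := one_mul _
  have hnorm := congrArg norm (betaIntegral_mul_zetaPoly hs0 hs1 m)
  rw [norm_mul, norm_mul, Complex.norm_ofNat] at hnorm
  have hb := norm_integral_le_of_norm_le (hI.const_mul ((m : ℝ) ^ (-ε)))
    ((ae_restrict_iff' measurableSet_Ioo).2 (ae_of_all _ hle))
  rw [integral_const_mul] at hb
  rw [div_mul_eq_mul_div, le_div_iff₀ hB, mul_comm, hnorm]
  linarith

lemma hasSum_pow_mul_cayleyModeDeriv {u : ℝ} (hu : 0 < u) {t : ℝ} (ht : |t| ≤ 1) :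
    HasSum (fun m : ℕ => t ^ m * cayleyModeDeriv m u)
      (((u + 1) ^ 2)⁻¹ * ((t - 1) / (1 - t * cayley u) ^ 2)) := by
  have hy := abs_cayley_lt_one hu
  set y := cayley u with hyd
  have hr : ‖t * y‖ < 1 := by
    rw [Real.norm_eq_abs, abs_mul]
    exact (mul_le_of_le_one_left (abs_nonneg _) ht).trans_lt hy
  have hr1 : 1 - t * y ≠ 0 := by
    have := (abs_lt.1 hr).2; linarith
  have h1 : HasSum (fun m : ℕ => (m : ℝ) * t ^ m * y ^ (m - 1)) (t / (1 - t * y) ^ 2) := by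
    have h := (hasSum_coe_mul_geometric_of_norm_lt_one hr).add (hasSum_geometric_of_norm_lt_one hr)
    have h' := h.mul_left t
    have key : HasSum (fun n : ℕ => ((n + 1 : ℕ) : ℝ) * t ^ (n + 1) * y ^ (n + 1 - 1))
        (t / (1 - t * y) ^ 2) := by
      convert! h' using 1
      · funext n
        rw [Nat.add_sub_cancel]; push_cast; rw [mul_pow]; ring
      · field_simp; ring
    have := (hasSum_nat_add_iff (f := fun m : ℕ => (m : ℝ) * t ^ m * y ^ (m - 1)) 1).1 key
    simpa using this
  convert! ((h1.mul_left (1 - y)).sub (hasSum_geometric_of_norm_lt_one hr)).mul_left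
    ((u + 1) ^ 2)⁻¹ using 1
  · funext m
    rw [cayleyModeDeriv, ← hyd, mul_pow]; ring
  · congr 1
    field_simp; ring

lemma summable_abs_cayleyModeDeriv {u : ℝ} (hu : 0 < u) :
    Summable fun m : ℕ => |cayleyModeDeriv m u| := by
  simpa using (hasSum_pow_mul_cayleyModeDeriv hu (t := 1) (by simp)).summable.abs

lemma hasSum_pow_mul_cayleyModeDeriv' {u : ℝ} (hu : 0 < u) {x : ℝ} (hx : x ∈ Ioo (0 : ℝ) 1) :
    HasSum (fun m : ℕ => (1 - 2 * x) ^ m * cayleyModeDeriv m u)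
      (-(x / (2 * (1 - x + u * x) ^ 2))) := by
  obtain ⟨h0, h1⟩ := hx
  have hd : 0 < 1 - x + u * x := by have := mul_pos hu h0; linarith
  convert! hasSum_pow_mul_cayleyModeDeriv hu (t := 1 - 2 * x)
    (by rw [abs_le]; constructor <;> linarith) using 1
  have h2 : 1 - (1 - 2 * x) * cayley u = 2 * (1 - x + u * x) / (u + 1) := by
    unfold cayley; field_simp; ring
  rw [h2]
  field_simp
  ring

/-- The map `x ↦ u x / (1 - x + u x)` of `(0, 1)` onto itself multiplies the coordinate `x / (1 - x)`
by `u`. -/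
lemma image_moebius {u : ℝ} (hu : 0 < u) :
    (fun x : ℝ => u * x / (1 - x + u * x)) '' Ioo 0 1 = Ioo 0 1 := by
  ext w
  constructor
  · rintro ⟨x, ⟨h0, h1⟩, rfl⟩
    have h := mul_pos hu h0
    have hd : 0 < 1 - x + u * x := by linarith
    refine ⟨by positivity, ?_⟩
    simp only
    rw [div_lt_one hd]; linarith
  · rintro ⟨h0, h1⟩
    have h := mul_pos hu (sub_pos.2 h1)
    have hd : 0 < w + u * (1 - w) := by linarith
    refine ⟨w / (w + u * (1 - w)), ⟨by positivity, ?_⟩, ?_⟩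
    · rw [div_lt_one hd]; linarith
    · have : 1 - w / (w + u * (1 - w)) + u * (w / (w + u * (1 - w))) =
          u / (w + u * (1 - w)) := by field_simp; ring
      simp only
      rw [this]; field_simp

lemma mul_betaWeight_eq (s : ℂ) {x : ℝ} (hx : x ∈ Ioo (0 : ℝ) 1) :
    (x : ℂ) * betaWeight s x = ((x / (1 - x) : ℝ) : ℂ) ^ s := by
  have hx0 : (x : ℂ) ≠ 0 := by exact_mod_cast hx.1.ne'
  have hx1 : 0 < 1 - x := by linarith [hx.2]
  rw [betaWeight, div_eq_mul_inv, Complex.ofReal_mul,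
    Complex.mul_cpow_ofReal_nonneg hx.1.le (inv_nonneg.2 hx1.le), Complex.cpow_sub _ _ hx0,
    Complex.cpow_one, ← mul_assoc, mul_div_cancel₀ _ hx0, Complex.ofReal_inv,
    Complex.inv_cpow _ _ (by rw [Complex.arg_ofReal_of_nonneg hx1.le]; exact Real.pi_pos.ne),
    Complex.cpow_neg]
  push_cast; rfl

/-- In the coordinate `x / (1 - x)` the weight is a pure power, so the substitution that scales this
coordinate by `u` reduces the integral to a beta integral. -/
lemma integral_mul_betaWeight_div {u : ℝ} (hu : 0 < u) (hs0 : 0 < s.re) (hs1 : s.re < 1) :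
    ∫ x in Ioo (0 : ℝ) 1, ((x / (2 * (1 - x + u * x) ^ 2) : ℝ) : ℂ) * betaWeight s x =
      (u : ℂ) ^ (-s - 1) * s * s.betaIntegral (1 - s) / 2 := by
  have hu0 : (u : ℂ) ≠ 0 := by exact_mod_cast hu.ne'
  have hd : ∀ x ∈ Ioo (0 : ℝ) 1, 0 < 1 - x + u * x := fun x hx => by
    have := mul_pos hu hx.1; linarith [hx.2]
  have h1 : ∫ w in Ioo (0 : ℝ) 1, ((w / (1 - w) : ℝ) : ℂ) ^ s = s * s.betaIntegral (1 - s) := by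
    have h := integral_pow_mul_betaWeight hs0 hs1 1
    simp only [pow_one, ascPochhammer_one, Polynomial.eval_X, Nat.factorial_one, Nat.cast_one,
      div_one] at h
    rw [← h]
    exact setIntegral_congr_fun measurableSet_Ioo fun x hx => (mul_betaWeight_eq s hx).symm
  have hder : ∀ x ∈ Ioo (0 : ℝ) 1, HasDerivWithinAt (fun x : ℝ => u * x / (1 - x + u * x))
      (u / (1 - x + u * x) ^ 2) (Ioo 0 1) x := by
    intro x hx
    have hdx := (hd x hx).ne'
    have h := (((hasDerivAt_id x).const_mul u).div
      (((hasDerivAt_id x).const_sub 1).add ((hasDerivAt_id x).const_mul u)) hdx).hasDerivWithinAt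
        (s := Ioo 0 1)
    convert! h using 1
    simp only [id, Pi.add_apply]
    congr 1; ring
  have hinj : InjOn (fun x : ℝ => u * x / (1 - x + u * x)) (Ioo 0 1) := by
    intro x hx z hz h
    simp only at h
    rw [div_eq_div_iff (hd x hx).ne' (hd z hz).ne'] at h
    have : u * (x - z) = 0 := by linear_combination h
    rcases mul_eq_zero.1 this with h | h
    · exact absurd h hu.ne'
    · linarith
  have h2 := integral_image_eq_integral_abs_deriv_smul measurableSet_Ioo hder hinj
    (fun w => ((w / (1 - w) : ℝ) : ℂ) ^ s)
  rw [image_moebius hu, h1] at h2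
  have h3 : ∀ x ∈ Ioo (0 : ℝ) 1, ((x / (2 * (1 - x + u * x) ^ 2) : ℝ) : ℂ) * betaWeight s x =
      ((u : ℂ) ^ (-s - 1) / 2) * (|u / (1 - x + u * x) ^ 2| •
        (((u * x / (1 - x + u * x)) / (1 - u * x / (1 - x + u * x)) : ℝ) : ℂ) ^ s) := by
    intro x hx
    have hdx := hd x hx
    have hx1 : 0 < 1 - x := by linarith [hx.2]
    have hw : (u * x / (1 - x + u * x)) / (1 - u * x / (1 - x + u * x)) = u * (x / (1 - x)) := by
      have : 1 - u * x / (1 - x + u * x) = (1 - x) / (1 - x + u * x) := by field_simp; ring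
      rw [this]; field_simp
    rw [hw, Complex.ofReal_mul u, Complex.mul_cpow_ofReal_nonneg hu.le (div_nonneg hx.1.le hx1.le),
      ← mul_betaWeight_eq s hx, abs_of_nonneg (by positivity), Complex.real_smul,
      Complex.cpow_sub _ _ hu0, Complex.cpow_neg, Complex.cpow_one]
    have hus : (u : ℂ) ^ s ≠ 0 := by simp [Complex.cpow_eq_zero_iff, hu0]
    have hdc : (1 : ℂ) - x + u * x ≠ 0 := by exact_mod_cast hdx.ne'
    push_cast
    field_simp
  rw [setIntegral_congr_fun measurableSet_Ioo h3, integral_const_mul, ← h2]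
  ring

/-- The derivative in `u` of the expansion `u ^ (-s) = ∑ m, P_m(s) g_m(u)`. -/
lemma hasSum_zetaPoly_mul_cayleyModeDeriv (hs0 : 0 < s.re) (hs1 : s.re < 1) {u : ℝ} (hu : 0 < u) :
    HasSum (fun m : ℕ => zetaPoly m s * (cayleyModeDeriv m u : ℂ)) (-s * (u : ℂ) ^ (-s - 1)) := by
  set F : ℕ → ℝ → ℂ := fun m x =>
    (cayleyModeDeriv m u : ℂ) * ((1 - 2 * (x : ℂ)) ^ m * betaWeight s x)
  have hW := integrableOn_betaWeight hs0 hs1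
  have hint : ∀ m : ℕ, IntegrableOn
      (fun x : ℝ => (1 - 2 * (x : ℂ)) ^ m * betaWeight s x) (Ioo 0 1) := by
    intro m
    refine hW.bdd_mul (c := 1) (by fun_prop) ?_
    refine (ae_restrict_iff' measurableSet_Ioo).2 (ae_of_all _ fun x hx => ?_)
    have : ‖1 - 2 * (x : ℂ)‖ = |1 - 2 * x| := by
      rw [← Real.norm_eq_abs, ← Complex.norm_real]; push_cast; rfl
    rw [norm_pow, this]
    exact pow_le_one₀ (abs_nonneg _) (abs_le.2 ⟨by linarith [hx.2], by linarith [hx.1]⟩)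
  have hFi : ∀ m, Integrable (F m) (volume.restrict (Ioo 0 1)) := fun m => (hint m).const_mul _
  have hle : ∀ m, ∫ x in Ioo (0 : ℝ) 1, ‖F m x‖ ≤
      |cayleyModeDeriv m u| * ∫ x in Ioo (0 : ℝ) 1, ‖betaWeight s x‖ := by
    intro m
    rw [← integral_const_mul]
    refine setIntegral_mono_on (hFi m).norm (hW.norm.const_mul _) measurableSet_Ioo fun x hx => ?_
    have : ‖1 - 2 * (x : ℂ)‖ = |1 - 2 * x| := by
      rw [← Real.norm_eq_abs, ← Complex.norm_real]; push_cast; rfl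
    rw [norm_mul, norm_mul, norm_pow, this, Complex.norm_real, Real.norm_eq_abs]
    refine mul_le_mul_of_nonneg_left (mul_le_of_le_one_left (norm_nonneg _) ?_) (abs_nonneg _)
    exact pow_le_one₀ (abs_nonneg _) (abs_le.2 ⟨by linarith [hx.2], by linarith [hx.1]⟩)
  have hsum := hasSum_integral_of_summable_integral_norm hFi
    (Summable.of_nonneg_of_le (fun m => integral_nonneg fun x => norm_nonneg _) hle
      ((summable_abs_cayleyModeDeriv hu).mul_right _))
  have htsum : ∫ x in Ioo (0 : ℝ) 1, ∑' m, F m x =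
      ∫ x in Ioo (0 : ℝ) 1, -(((x / (2 * (1 - x + u * x) ^ 2) : ℝ) : ℂ) * betaWeight s x) := by
    refine setIntegral_congr_fun measurableSet_Ioo fun x hx => ?_
    have h := (Complex.hasSum_ofReal.2 (hasSum_pow_mul_cayleyModeDeriv' hu hx)).mul_right
      (betaWeight s x)
    have h' : HasSum (fun m => F m x)
        (-(((x / (2 * (1 - x + u * x) ^ 2) : ℝ) : ℂ) * betaWeight s x)) := by
      convert! h using 1
      · funext m; simp only [F]; push_cast; ring
      · rw [Complex.ofReal_neg, neg_mul]
    exact h'.tsum_eq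
  rw [htsum, integral_neg, integral_mul_betaWeight_div hu hs0 hs1] at hsum
  have hB := betaIntegral_one_sub_ne_zero hs0 hs1
  convert! hsum.mul_left (2 / s.betaIntegral (1 - s)) using 1
  · funext m
    simp only [F]
    rw [integral_const_mul]
    have h := betaIntegral_mul_zetaPoly hs0 hs1 m
    field_simp
    linear_combination (cayleyModeDeriv m u : ℂ) * h
  · field_simp

end

/-! ### The zeta function in the critical strip -/

/-- The fractional part restricted to `(1, ∞)`. Its Mellin transform is holomorphic at `-s` for all
`s` with positive real part, while that of `{t}` itself only converges in the strip
`0 < s.re < 1`. -/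
noncomputable def fractTail : ℝ → ℂ := indicator (Ioi 1) fun t => ((Int.fract t : ℝ) : ℂ)

lemma norm_fractTail_le (t : ℝ) : ‖fractTail t‖ ≤ 1 := by
  refine (norm_indicator_le_norm_self _ _).trans ?_
  rw [Complex.norm_real, Real.norm_eq_abs, abs_of_nonneg (Int.fract_nonneg t)]
  exact (Int.fract_lt_one t).le

lemma locallyIntegrable_fractTail : LocallyIntegrable fractTail := by
  have hm : AEStronglyMeasurable fractTail :=
    ((Complex.measurable_ofReal.comp measurable_fract).indicator
      measurableSet_Ioi).aestronglyMeasurable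
  refine (locallyIntegrable_const (1 : ℝ)).mono hm (ae_of_all _ fun t => ?_)
  simpa using norm_fractTail_le t

lemma fractTail_isBigO_atTop : fractTail =O[atTop] (· ^ (-0 : ℝ)) := by
  refine Asymptotics.IsBigO.of_bound 1 (Eventually.of_forall fun t => ?_)
  simpa using norm_fractTail_le t

lemma fractTail_isBigO_zero (b : ℝ) : fractTail =O[𝓝[>] 0] (· ^ (-b)) := by
  refine Asymptotics.IsBigO.of_bound 1 ?_
  have : Iio (1 : ℝ) ∈ 𝓝[>] (0 : ℝ) := mem_nhdsWithin_of_mem_nhds (Iio_mem_nhds zero_lt_one)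
  filter_upwards [this] with t ht
  have : t ∉ Ioi (1 : ℝ) := fun h => lt_asymm (mem_Ioi.1 h) ht
  rw [fractTail, indicator_of_notMem this]
  simp [abs_nonneg]

lemma mellin_fractTail (s : ℂ) :
    mellin fractTail (-s) = ∫ t in Ioi (1 : ℝ), ((Int.fract t : ℝ) : ℂ) * (t : ℂ) ^ (-s - 1) := by
  have h : ∀ t : ℝ, (t : ℂ) ^ (-s - 1) • fractTail t =
      (Ioi (1 : ℝ)).indicator (fun t => ((Int.fract t : ℝ) : ℂ) * (t : ℂ) ^ (-s - 1)) t := by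
    intro t
    by_cases ht : t ∈ Ioi (1 : ℝ) <;> simp [fractTail, ht, mul_comm]
  simp_rw [mellin, h]
  rw [setIntegral_indicator measurableSet_Ioi]
  congr 2
  ext t
  simp only [mem_inter_iff, mem_Ioi]
  constructor
  · exact fun h => h.2
  · exact fun h => ⟨zero_lt_one.trans h, h⟩

lemma mellinConvergent_fractTail {s : ℂ} (hs : 0 < s.re) : MellinConvergent fractTail (-s) :=
  mellinConvergent_of_isBigO_rpow (locallyIntegrable_fractTail.locallyIntegrableOn _)
    fractTail_isBigO_atTop (by simpa using hs) (fractTail_isBigO_zero (-s.re - 1)) (by simp)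

lemma integrableOn_fract_cpow {s : ℂ} (hs : 0 < s.re) :
    IntegrableOn (fun t : ℝ => ((Int.fract t : ℝ) : ℂ) * (t : ℂ) ^ (-s - 1)) (Ioi 1) := by
  have h := (mellinConvergent_fractTail hs).mono_set (Ioi_subset_Ioi zero_le_one)
  refine h.congr_fun (fun t ht => ?_) measurableSet_Ioi
  simp [fractTail, mem_Ioi.1 ht, mul_comm]

lemma differentiableAt_mellin_fractTail {s : ℂ} (hs : 0 < s.re) :
    DifferentiableAt ℂ (fun s => mellin fractTail (-s)) s := by
  have h := mellin_differentiableAt_of_isBigO_rpow (s := -s)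
    (locallyIntegrable_fractTail.locallyIntegrableOn _)
    fractTail_isBigO_atTop (by simpa using hs) (fractTail_isBigO_zero (-s.re - 1)) (by simp)
  exact h.comp s differentiableAt_id.neg

lemma riemannZeta_eq_fract_integral_of_one_lt {s : ℂ} (hs : 1 < s.re) :
    riemannZeta s = s / (s - 1) - s * mellin fractTail (-s) := by
  have h := LSeries_eq_mul_integral' 1 zero_le_one hs (by
    refine Asymptotics.IsBigO.of_bound 1 (Eventually.of_forall fun n => ?_)
    simp)
  rw [LSeries_one_eq_riemannZeta hs] at h
  have hs0 : 0 < s.re := by linarith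
  have hs1 : s - 1 ≠ 0 := by
    intro h; rw [sub_eq_zero.1 h] at hs; simp at hs
  have hI : IntegrableOn (fun t : ℝ => (t : ℂ) ^ (-s)) (Ioi 1) :=
    integrableOn_Ioi_cpow_of_lt (by simpa using hs) zero_lt_one
  have hval : ∫ t in Ioi (1 : ℝ), (t : ℂ) ^ (-s) = 1 / (s - 1) := by
    rw [integral_Ioi_cpow_of_lt (by simpa using hs) zero_lt_one]
    have : -s + 1 ≠ 0 := fun h => hs1 (by linear_combination -h)
    simp
    field_simp
    ring
  rw [h, mellin_fractTail, ← mul_one_div s, ← hval, ← mul_sub,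
    ← integral_sub hI (integrableOn_fract_cpow hs0)]
  congr 1
  refine setIntegral_congr_fun measurableSet_Ioi fun t ht => ?_
  have ht0 : (t : ℂ) ≠ 0 := by
    exact_mod_cast (zero_lt_one.trans (mem_Ioi.1 ht)).ne'
  have hfl : ((⌊t⌋₊ : ℕ) : ℂ) = t - ((Int.fract t : ℝ) : ℂ) := by
    have h1 : ((⌊t⌋₊ : ℕ) : ℝ) = t - Int.fract t := by
      rw [natCast_floor_eq_intCast_floor (zero_le_one.trans (le_of_lt ht))]
      rw [Int.self_sub_fract]
    exact_mod_cast congrArg (fun x : ℝ => (x : ℂ)) h1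
  simp only [Pi.one_apply, Finset.sum_const, Nat.card_Icc, Nat.add_sub_cancel, nsmul_eq_mul,
    mul_one]
  rw [hfl, sub_mul, neg_add', Complex.cpow_sub _ _ ht0, Complex.cpow_one, mul_div_cancel₀ _ ht0]

/-- Analytic continuation of `riemannZeta_eq_fract_integral_of_one_lt` to the right half-plane, for
the entire function `riemannZeta₀ s = riemannZeta s - 1 / (s - 1)`. -/
lemma riemannZeta₀_eq {s : ℂ} (hs : 0 < s.re) :
    riemannZeta₀ s = 1 - s * mellin fractTail (-s) := by
  have hopen : IsOpen {s : ℂ | 0 < s.re} := isOpen_lt continuous_const Complex.continuous_re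
  have h1 : AnalyticOnNhd ℂ riemannZeta₀ {s : ℂ | 0 < s.re} :=
    differentiable_riemannZeta₀.differentiableOn.analyticOnNhd hopen
  have h2 : AnalyticOnNhd ℂ (fun s => 1 - s * mellin fractTail (-s)) {s : ℂ | 0 < s.re} := by
    refine DifferentiableOn.analyticOnNhd (fun z hz => ?_) hopen
    exact ((differentiableAt_const _).sub
      (differentiableAt_id.mul (differentiableAt_mellin_fractTail hz))).differentiableWithinAt
  have hconn : IsPreconnected {s : ℂ | 0 < s.re} := (convex_halfSpace_re_gt 0).isPreconnected
  refine h1.eqOn_of_preconnected_of_eventuallyEq h2 hconn (z₀ := 2) (by simp) ?_ hs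
  filter_upwards [(isOpen_lt continuous_const Complex.continuous_re).mem_nhds
    (show (2 : ℂ) ∈ {s : ℂ | 1 < s.re} by simp)] with z hz
  have hz1 : z ≠ 1 := by
    rintro rfl; simp at hz
  have hz1' := sub_ne_zero.2 hz1
  have h3 := riemannZeta_eq_inv_sub_add hz1
  rw [riemannZeta_eq_fract_integral_of_one_lt hz] at h3
  have h4 : z / (z - 1) = (z - 1)⁻¹ + 1 := by field_simp; ring
  linear_combination -h3 + h4

/-- In the critical strip the pole term `s / (s - 1)` is the contribution of `(0, 1)`. -/
theorem riemannZeta_eq_fract_integral {s : ℂ} (hs0 : 0 < s.re) (hs1 : s.re < 1) :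
    riemannZeta s = ∫ u in Ioi (0 : ℝ), ((Int.fract u : ℝ) : ℂ) * (-s * (u : ℂ) ^ (-s - 1)) := by
  have hne : s ≠ 1 := by rintro rfl; simp at hs1
  have hs1' := sub_ne_zero.2 hne
  have hcpow : ∀ u ∈ Ioo (0 : ℝ) 1, (u : ℂ) ^ (-s) = ((Int.fract u : ℝ) : ℂ) * (u : ℂ) ^ (-s - 1) := by
    intro u hu
    have hu0 : (u : ℂ) ≠ 0 := by exact_mod_cast hu.1.ne'
    rw [Int.fract_eq_self.2 ⟨hu.1.le, hu.2⟩, Complex.cpow_sub _ _ hu0, Complex.cpow_one,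
      mul_div_cancel₀ _ hu0]
  have hI0 : IntervalIntegrable (fun u : ℝ => (u : ℂ) ^ (-s)) volume 0 1 :=
    intervalIntegral.intervalIntegrable_cpow' (by simpa using hs1)
  have hI : IntegrableOn (fun u : ℝ => ((Int.fract u : ℝ) : ℂ) * (u : ℂ) ^ (-s - 1)) (Ioc 0 1) := by
    rw [integrableOn_Ioc_iff_integrableOn_Ioo]
    refine (IntegrableOn.mono_set ?_ Ioo_subset_Ioc_self).congr_fun hcpow measurableSet_Ioo
    exact (intervalIntegrable_iff_integrableOn_Ioc_of_le zero_le_one).1 hI0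
  have hval : ∫ u in Ioc (0 : ℝ) 1, ((Int.fract u : ℝ) : ℂ) * (u : ℂ) ^ (-s - 1) = 1 / (1 - s) := by
    rw [integral_Ioc_eq_integral_Ioo, ← setIntegral_congr_fun measurableSet_Ioo hcpow,
      ← integral_Ioc_eq_integral_Ioo, ← intervalIntegral.integral_of_le zero_le_one,
      integral_cpow (Or.inl (by simpa using hs1))]
    have : -s + 1 ≠ 0 := fun h => hs1' (by linear_combination -h)
    simp [Complex.zero_cpow this]
    ring
  simp_rw [mul_left_comm _ (-s)]
  rw [integral_const_mul, ← Ioc_union_Ioi_eq_Ioi zero_le_one,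
    setIntegral_union (Ioc_disjoint_Ioi le_rfl) measurableSet_Ioi hI (integrableOn_fract_cpow hs0),
    hval, ← mellin_fractTail, riemannZeta_eq_inv_sub_add hne, riemannZeta₀_eq hs0]
  have : (1 : ℂ) - s ≠ 0 := sub_ne_zero.2 hne.symm
  rw [show s - 1 = -(1 - s) by ring]
  field_simp
  ring

/-! ### The expansion of the zeta function -/

theorem theorem8 (s : ℂ) (hs0 : 0 < s.re) (hs1 : s.re < 1) :
    HasSum (fun m : ℕ => zetaCoeff m * zetaPoly m s) (riemannZeta s) := by
  obtain ⟨ε, hε, C, hC⟩ := exists_norm_zetaPoly_le hs0 hs1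
  -- exchange the sum over `m` with the integral defining the coefficients
  set F : ℕ → ℝ → ℂ := fun m u => ((Int.fract u * cayleyModeDeriv m u : ℝ) : ℂ) * zetaPoly m s
  have hFi : ∀ m, Integrable (F m) (volume.restrict (Ioi 0)) := fun m =>
    (integrableOn_fract_mul_cayleyModeDeriv m).ofReal.mul_const _
  have hnorm : ∀ m, ∫ u in Ioi (0 : ℝ), ‖F m u‖ ≤ 2 / (m + 1) * ‖zetaPoly m s‖ := by
    intro m
    simp only [F, norm_mul (_ : ℂ) (zetaPoly m s), Complex.norm_real]
    rw [integral_mul_const]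
    exact mul_le_mul_of_nonneg_right (integral_norm_fract_mul_cayleyModeDeriv_le m)
      (norm_nonneg _)
  have hsummable : Summable fun m => ∫ u in Ioi (0 : ℝ), ‖F m u‖ := by
    refine (summable_nat_add_iff 1).1 (Summable.of_nonneg_of_le
      (fun m => integral_nonneg fun u => norm_nonneg _) (fun m => ?_)
      (((summable_nat_add_iff 1).2 (Real.summable_nat_rpow.2
        (by linarith : -1 - ε < -1))).mul_left (2 * C)))
    have hm : (0 : ℝ) < (m + 1 : ℕ) := by exact_mod_cast m.succ_pos
    have hP := hC (m + 1) m.succ_ne_zero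
    calc ∫ u in Ioi (0 : ℝ), ‖F (m + 1) u‖
        ≤ 2 / ((m + 1 : ℕ) + 1) * ‖zetaPoly (m + 1) s‖ := hnorm _
      _ ≤ 2 / (m + 1 : ℕ) * ‖zetaPoly (m + 1) s‖ := by gcongr; linarith
      _ ≤ 2 / (m + 1 : ℕ) * (C * ((m + 1 : ℕ) : ℝ) ^ (-ε)) := by gcongr
      _ = 2 * C * ((m + 1 : ℕ) : ℝ) ^ (-1 - ε) := by
        rw [sub_eq_add_neg, Real.rpow_add hm, Real.rpow_neg_one]; ring
  have hsum := hasSum_integral_of_summable_integral_norm hFi hsummable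
  rw [riemannZeta_eq_fract_integral hs0 hs1]
  convert! hsum using 1
  · funext m
    simp only [F]
    rw [integral_mul_const, integral_complex_ofReal, zetaCoeff_eq_integral]
  · refine setIntegral_congr_fun measurableSet_Ioi fun u hu => ?_
    have h := (hasSum_zetaPoly_mul_cayleyModeDeriv hs0 hs1 hu).mul_left
      ((Int.fract u : ℝ) : ℂ)
    refine (h.tsum_eq.symm.trans (tsum_congr fun m => ?_))
    simp only [F]; push_cast; ring
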